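/- Let $n\ge 2$, let $\alpha>1$, and let $\psi:[0,+\infty)\to[0,+\infty)$ be a model function, that is, $\psi\in C^\infty([0,+\infty))$, $\psi>0$ on $(0,+\infty)$, $\psi(0)=0$, $\psi'(0)=1$, and $\psi^{(2k)}(0)=0$ for all $k\in\mathbb{N}$. Let $\mathbb{M}^n$ be the associated model manifold: $\mathbb{R}^n$, with pole $o=0$, endowed with the smooth Riemannian metric which, in polar coordinates $(r,\theta)\in(0,+\infty)\times\mathbb{S}^{n-1}$ about $o$, reads $$\mathsf{g}=dr^2+\psi^2(r)\,\mathsf{g}_{\mathbb{S}^{n-1}},$$ where $\mathsf{g}_{\mathbb{S}^{n-1}}$ is the round metric of the unit sphere. Denote by $dV$ its Riemannian volume measure and by $\Delta$ its Laplace–Beltrami operator. Suppose that, for some $K,r_0>0$, $$\frac{\psi'(r)}{\psi(r)}\le\frac{K}{r}\quad\text{for all } r>0,\qquad \psi(r)\le K\,r^\alpha\quad\text{for all } r\ge r_0 .$$ Let $$1<q\le\tilde 2_\alpha:=\frac{\alpha(n-1)+1}{\alpha(n-1)-1}.$$ If $u\ge 0$ is a (not necessarily radial) function on $\mathbb{M}^n$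 that satisfies $-\Delta u\ge u^q$ on $\mathbb{M}^n$ in the sense of distributions, i.e. $u,u^q\in L^1_{\mathrm{loc}}(\mathbb{M}^n)$ and $$\int_{\mathbb{M}^n}u^q\,\varphi\,dV\le-\int_{\mathbb{M}^n}u\,\Delta\varphi\,dV\qquad\text{for all }\varphi\in C_c^\infty(\mathbb{M}^n),\ \varphi\ge 0,$$ then $u=0$ almost everywhere on $\mathbb{M}^n$. -/

import Mathlib

open Set MeasureTheory
open scoped ContDiff

noncomputable section

namespace LaneEmden

/-- Model functions `ψ : [0,∞) → [0,∞)`: smooth up to `0`, positive on `(0,∞)`, with `ψ(0) = 0`,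
`ψ'(0) = 1` and vanishing derivatives of even order at `0`. Only the values of `ψ` on `[0,∞)`
matter; derivatives at `0` are one-sided. -/
structure IsModelFunction (ψ : ℝ → ℝ) : Prop where
  smooth : ContDiffOn ℝ ∞ ψ (Ici 0)
  pos : ∀ r : ℝ, 0 < r → 0 < ψ r
  map_zero : ψ 0 = 0
  deriv_zero : derivWithin ψ (Ici 0) 0 = 1
  even_deriv_zero : ∀ k : ℕ, iteratedDerivWithin (2 * k) ψ (Ici 0) 0 = 0

/-- `ℝⁿ`, the underlying smooth manifold of a model manifold; the pole `o` is the origin. -/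
abbrev Space (n : ℕ) : Type := EuclideanSpace ℝ (Fin n)

/-- The polar radius `r(x)`. -/
def polarRadius {n : ℕ} (x : Space n) : ℝ := ‖x‖

/-- The polar angle `θ(x)`, a point of the unit sphere of `ℝⁿ` when `x ≠ 0`. -/
def polarAngle {n : ℕ} (x : Space n) : Space n := ‖x‖⁻¹ • x

open Classical in
/-- The metric `g = dr² + ψ(r)² g_{S^{n-1}}`, as a field of bilinear forms on `ℝⁿ`. The round
metric of the sphere is the restriction of the Euclidean inner product, so that
`g_x(v, w) = dr_x(v) dr_x(w) + ψ(r)² ⟨dθ_x(v), dθ_x(w)⟩` away from the pole. At the pole, where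
polar coordinates degenerate, it is extended (smoothly, because `ψ` is a model function) by the
Euclidean inner product. -/
def modelMetric {n : ℕ} (ψ : ℝ → ℝ) (x v w : Space n) : ℝ :=
  if x = 0 then inner ℝ v w
  else
    fderiv ℝ polarRadius x v * fderiv ℝ polarRadius x w +
      ψ (polarRadius x) ^ 2 * inner ℝ (fderiv ℝ polarAngle x v) (fderiv ℝ polarAngle x w)

/-- The `i`-th coordinate vector field on `ℝⁿ`. -/
def coordVec {n : ℕ} (i : Fin n) : Space n := EuclideanSpace.single i 1

/-- The matrix `(g_{ij}(x))` of a metric in the global Cartesian coordinates of `ℝⁿ`. -/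
def metricMatrix {n : ℕ} (g : Space n → Space n → Space n → ℝ) (x : Space n) :
    Matrix (Fin n) (Fin n) ℝ :=
  Matrix.of fun i j => g x (coordVec i) (coordVec j)

/-- The Riemannian volume density `√(det (g_{ij}))`. -/
def volumeDensity {n : ℕ} (g : Space n → Space n → Space n → ℝ) (x : Space n) : ℝ :=
  √(metricMatrix g x).det

/-- The Riemannian volume measure `dV = √(det (g_{ij})) dx`. -/
def riemannianVolume {n : ℕ} (g : Space n → Space n → Space n → ℝ) : Measure (Space n) :=
  (volume : Measure (Space n)).withDensity fun x => ENNReal.ofReal (volumeDensity g x)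

/-- The `i`-th component `∑ⱼ g^{ij} ∂ⱼ f` of the Riemannian gradient. -/
def gradComponent {n : ℕ} (g : Space n → Space n → Space n → ℝ) (f : Space n → ℝ)
    (i : Fin n) (x : Space n) : ℝ :=
  ∑ j, (metricMatrix g x)⁻¹ i j * fderiv ℝ f x (coordVec j)

/-- The Laplace–Beltrami operator
`Δf = (det g)^{-1/2} ∑ᵢ ∂ᵢ ((det g)^{1/2} ∑ⱼ g^{ij} ∂ⱼ f)`. -/
def laplaceBeltrami {n : ℕ} (g : Space n → Space n → Space n → ℝ) (f : Space n → ℝ)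
    (x : Space n) : ℝ :=
  (volumeDensity g x)⁻¹ *
    ∑ i, fderiv ℝ (fun y => volumeDensity g y * gradComponent g f i y) x (coordVec i)

/-- `-Δu ≥ u^q` in the sense of distributions: `u` and `u^q` are locally integrable functions and
`∫ u^q φ dV ≤ ∫ u (-Δφ) dV` for every nonnegative smooth compactly supported `φ`. -/
structure IsDistribSupersolution {n : ℕ} (g : Space n → Space n → Space n → ℝ) (q : ℝ)
    (u : Space n → ℝ) : Prop where
  locallyIntegrable : LocallyIntegrable u (riemannianVolume g)
  locallyIntegrable_rpow : LocallyIntegrable (fun x => u x ^ q) (riemannianVolume g)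
  integral_le : ∀ φ : Space n → ℝ, ContDiff ℝ ∞ φ → HasCompactSupport φ → (∀ x, 0 ≤ φ x) →
    ∫ x, u x ^ q * φ x ∂(riemannianVolume g) ≤
      ∫ x, u x * (-laplaceBeltrami g φ x) ∂(riemannianVolume g)

/-- The exponent `(α(n-1)+1)/(α(n-1)-1)`. -/
def lowerCriticalExponent (n : ℕ) (α : ℝ) : ℝ :=
  (α * ((n : ℝ) - 1) + 1) / (α * ((n : ℝ) - 1) - 1)

end LaneEmden

end

namespace LaneEmden

open Filter Topology Matrix

/-! ### The model metric and its Laplacian on radial functions in Cartesian coordinates -/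

section Geometry

variable {n : ℕ}

/-! The proof is the test-function method of Mitidieri and Pokhozhaev. Write `N = n - 1` and `q' = q
/ (q - 1)`, and test with `φ(x) = g(‖x‖² / R²)`, where `g` is a nonincreasing cutoff whose first two
derivatives are at most `C g^(1/q)`. Since `g' ≤ 0`, the upper bound on `ψ'/ψ` gives `-Δφ ≤ D R⁻²
φ^(1/q)` on the annulus `R ≤ ‖x‖ ≤ 2R`, and `Δφ = 0` elsewhere (`neg_laplaceBeltrami_cutoff_le`).

Young's inequality with a free weight `c` bounds `∫ u^q φ` by `c^q ∫_annulus u^q φ` plus `(D R⁻² /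
c)^q'` times the volume of the annulus. That volume is `O(R^(αN+1))`, and `αN + 1 ≤ 2q'` is exactly
the condition on `q`, so the last term is at most `E c^(-q')` uniformly in `R`
(`integral_rpow_mul_cutoff_le`).

A small `c` absorbs the annulus term and shows that `u^q` is integrable. The annulus integral is
then a vanishing tail, so `R → ∞` at fixed `c` yields `∫ u^q ≤ E c^(-q')`, and `c → ∞` forces `u =
0`. Keeping the annulus and the weight is what reaches the critical exponent. -/

lemma hasFDerivAt_norm {x : Space n} (hx : x ≠ 0) :
    HasFDerivAt (fun y : Space n => ‖y‖) (‖x‖⁻¹ • innerSL ℝ x) x := by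
  have hr : ‖x‖ ≠ 0 := norm_ne_zero_iff.2 hx
  have h := (hasStrictFDerivAt_norm_sq x).hasFDerivAt.sqrt (pow_ne_zero 2 hr)
  simp only [Real.sqrt_sq (norm_nonneg _)] at h
  convert! h using 1
  ext v
  simp
  field_simp

lemma fderiv_polarRadius_apply {x : Space n} (hx : x ≠ 0) (v : Space n) :
    fderiv ℝ polarRadius x v = ‖x‖⁻¹ * inner ℝ x v := by
  have h : HasFDerivAt (polarRadius (n := n)) (‖x‖⁻¹ • innerSL ℝ x) x := hasFDerivAt_norm hx
  simp [h.fderiv]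

lemma fderiv_polarAngle_apply {x : Space n} (hx : x ≠ 0) (v : Space n) :
    fderiv ℝ polarAngle x v = ‖x‖⁻¹ • v - (‖x‖⁻¹ ^ 3 * inner ℝ x v) • x := by
  have hr : ‖x‖ ≠ 0 := norm_ne_zero_iff.2 hx
  have h0 : HasFDerivAt (fun y : Space n => ‖y‖⁻¹) _ x :=
    (hasDerivAt_inv hr).comp_hasFDerivAt x (hasFDerivAt_norm hx)
  have h : HasFDerivAt (polarAngle (n := n)) _ x := h0.smul (hasFDerivAt_id x)
  rw [h.fderiv]
  simp only [_root_.add_apply, _root_.smul_apply, ContinuousLinearMap.id_apply,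
    ContinuousLinearMap.smulRight_apply, innerSL_apply_apply, smul_eq_mul, sub_eq_add_neg,
    ← neg_smul]
  congr 2
  field_simp

/-- With `s = ψ(r)/r`, the metric is `s²` times the Euclidean one plus a rank-one radial correction;
all later matrix computations rest on this form. -/
lemma modelMetric_apply (ψ : ℝ → ℝ) {x : Space n} (hx : x ≠ 0) (v w : Space n) :
    modelMetric ψ x v w = (ψ ‖x‖ / ‖x‖) ^ 2 * inner ℝ v w +
      (1 - (ψ ‖x‖ / ‖x‖) ^ 2) / ‖x‖ ^ 2 * (inner ℝ x v * inner ℝ x w) := by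
  have hr : ‖x‖ ≠ 0 := norm_ne_zero_iff.2 hx
  rw [modelMetric, if_neg hx, fderiv_polarRadius_apply hx, fderiv_polarRadius_apply hx,
    fderiv_polarAngle_apply hx, fderiv_polarAngle_apply hx]
  simp only [inner_sub_left, inner_sub_right, inner_smul_left, inner_smul_right,
    real_inner_self_eq_norm_sq, real_inner_comm x, polarRadius, RCLike.conj_to_real]
  field_simp
  ring

lemma inner_coordVec (x : Space n) (i : Fin n) : inner ℝ x (coordVec i) = x i := by
  simp [coordVec, EuclideanSpace.inner_single_right]

lemma metricMatrix_eq (ψ : ℝ → ℝ) {x : Space n} (hx : x ≠ 0) :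
    metricMatrix (modelMetric ψ) x = (ψ ‖x‖ / ‖x‖) ^ 2 • (1 : Matrix (Fin n) (Fin n) ℝ) +
      ((1 - (ψ ‖x‖ / ‖x‖) ^ 2) / ‖x‖ ^ 2) • vecMulVec x x := by
  ext i j
  simp only [metricMatrix, Matrix.of_apply, modelMetric_apply ψ hx, inner_coordVec,
    Matrix.add_apply, Matrix.smul_apply, vecMulVec_apply, smul_eq_mul, Matrix.one_apply]
  congr 2
  simp [coordVec, eq_comm]

lemma dotProduct_self_eq_norm_sq (x : Space n) : (x : Fin n → ℝ) ⬝ᵥ x = ‖x‖ ^ 2 := by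
  rw [EuclideanSpace.real_norm_sq_eq]
  simp [dotProduct, sq]

/-- The eigenvalues are `1` in the radial direction and `s²` on its `N`-dimensional orthogonal
complement; the rank-one determinant formula makes this precise. -/
lemma det_metricMatrix {ψ : ℝ → ℝ} {N : ℕ} {x : Space (N + 1)} (hx : x ≠ 0) (hψ : ψ ‖x‖ ≠ 0) :
    (metricMatrix (modelMetric ψ) x).det = ((ψ ‖x‖ / ‖x‖) ^ N) ^ 2 := by
  have hr : ‖x‖ ≠ 0 := norm_ne_zero_iff.2 hx
  set s := ψ ‖x‖ / ‖x‖ with hs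
  have hs0 : s ≠ 0 := div_ne_zero hψ hr
  have key : metricMatrix (modelMetric ψ) x = s ^ 2 • ((1 : Matrix (Fin (N + 1)) (Fin (N + 1)) ℝ) +
      replicateCol Unit (((1 - s ^ 2) / ‖x‖ ^ 2 / s ^ 2) • (x : Fin (N + 1) → ℝ)) *
        replicateRow Unit (x : Fin (N + 1) → ℝ)) := by
    rw [metricMatrix_eq ψ hx, ← hs, ← vecMulVec_eq, smul_add, smul_vecMulVec, smul_smul]
    congr 2
    field_simp
  rw [key, det_smul, det_one_add_replicateCol_mul_replicateRow, dotProduct_smul,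
    dotProduct_self_eq_norm_sq, smul_eq_mul, Fintype.card_fin]
  field_simp
  ring

lemma volumeDensity_eq {ψ : ℝ → ℝ} {N : ℕ} {x : Space (N + 1)} (hx : x ≠ 0) (hψ : 0 < ψ ‖x‖) :
    volumeDensity (modelMetric ψ) x = (ψ ‖x‖ / ‖x‖) ^ N := by
  rw [volumeDensity, det_metricMatrix hx hψ.ne', Real.sqrt_sq (by positivity)]

/-- Because the radial vector is fixed, radial functions have the same gradient as in Euclidean
space, and the inverse matrix need not be computed. -/
lemma metricMatrix_mulVec_self (ψ : ℝ → ℝ) {x : Space n} (hx : x ≠ 0) :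
    metricMatrix (modelMetric ψ) x *ᵥ (x : Fin n → ℝ) = x := by
  have hr : ‖x‖ ≠ 0 := norm_ne_zero_iff.2 hx
  rw [metricMatrix_eq ψ hx, add_mulVec, smul_mulVec, one_mulVec, smul_mulVec, vecMulVec_mulVec,
    dotProduct_self_eq_norm_sq, op_smul_eq_smul, smul_smul, ← add_smul,
    div_mul_cancel₀ _ (by positivity), add_sub_cancel, one_smul]

lemma inv_metricMatrix_mulVec_self {ψ : ℝ → ℝ} {N : ℕ} {x : Space (N + 1)} (hx : x ≠ 0)
    (hψ : ψ ‖x‖ ≠ 0) :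
    (metricMatrix (modelMetric ψ) x)⁻¹ *ᵥ (x : Fin (N + 1) → ℝ) = x := by
  have hr : ‖x‖ ≠ 0 := norm_ne_zero_iff.2 hx
  have hdet : IsUnit (metricMatrix (modelMetric ψ) x).det := by
    rw [det_metricMatrix hx hψ, isUnit_iff_ne_zero]
    exact pow_ne_zero _ (pow_ne_zero _ (div_ne_zero hψ hr))
  conv_lhs => rw [← metricMatrix_mulVec_self ψ hx]
  rw [mulVec_mulVec, nonsing_inv_mul _ hdet, one_mulVec]

lemma gradComponent_radial {ψ g : ℝ → ℝ} {R : ℝ} {N : ℕ} (hg : Differentiable ℝ g)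
    {x : Space (N + 1)} (hx : x ≠ 0) (hψ : ψ ‖x‖ ≠ 0) (i : Fin (N + 1)) :
    gradComponent (modelMetric ψ) (fun y => g (‖y‖ ^ 2 / R ^ 2)) i x =
      2 / R ^ 2 * deriv g (‖x‖ ^ 2 / R ^ 2) * x i := by
  have h : HasFDerivAt (fun y : Space (N + 1) => g (‖y‖ ^ 2 / R ^ 2)) _ x :=
    HasDerivAt.comp_hasFDerivAt x (hg _).hasDerivAt
      ((hasStrictFDerivAt_norm_sq x).hasFDerivAt.mul_const (R ^ 2)⁻¹)
  have h1 (j : Fin (N + 1)) :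
      fderiv ℝ (fun y : Space (N + 1) => g (‖y‖ ^ 2 / R ^ 2)) x (coordVec j) = x j * (2 / R ^ 2 * deriv g (‖x‖ ^ 2 / R ^ 2)) := by
    rw [h.fderiv]
    simp [inner_coordVec, div_eq_mul_inv]
    ring
  have h2 := congrFun (inv_metricMatrix_mulVec_self hx hψ) i
  rw [mulVec, dotProduct] at h2
  simp only [gradComponent, h1, ← mul_assoc]
  rw [← Finset.sum_mul, ← Finset.sum_mul, h2]
  ring

lemma fderiv_radial_mul_coord {h : ℝ → ℝ} {h' : ℝ} {x : Space n} (hx : x ≠ 0)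
    (hh : HasDerivAt h h' ‖x‖) (i : Fin n) :
    fderiv ℝ (fun y : Space n => h ‖y‖ * y i) x (coordVec i) = h' / ‖x‖ * x i ^ 2 + h ‖x‖ := by
  have h1 := (hh.comp_hasFDerivAt x (hasFDerivAt_norm hx)).mul
    (EuclideanSpace.proj (𝕜 := ℝ) i).hasFDerivAt
  have h2 : HasFDerivAt (fun y : Space n => h ‖y‖ * y i) _ x := h1
  rw [h2.fderiv]
  simp [inner_coordVec]
  simp [coordVec]
  ring

/-- Density times gradient is a field `h(r) x`, whose Euclidean divergence is `r h' + (N + 1) h`. -/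
lemma laplaceBeltrami_radial {ψ g : ℝ → ℝ} (hψ : IsModelFunction ψ) (hg : ContDiff ℝ ∞ g)
    {R : ℝ} (hR : R ≠ 0) {N : ℕ} {x : Space (N + 1)} (hx : x ≠ 0) :
    laplaceBeltrami (modelMetric ψ) (fun y => g (‖y‖ ^ 2 / R ^ 2)) x =
      2 / R ^ 2 * ((N * (‖x‖ * (deriv ψ ‖x‖ / ψ ‖x‖)) + 1) * deriv g (‖x‖ ^ 2 / R ^ 2) +
        2 * (‖x‖ ^ 2 / R ^ 2) * deriv (deriv g) (‖x‖ ^ 2 / R ^ 2)) := by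
  have hr : 0 < ‖x‖ := norm_pos_iff.2 hx
  have hp := hψ.pos _ hr
  have hdψ : HasDerivAt ψ (deriv ψ ‖x‖) ‖x‖ :=
    ((hψ.smooth.differentiableOn (by simp)).differentiableAt (Ici_mem_nhds hr)).hasDerivAt
  have hdg : Differentiable ℝ (deriv g) :=
    (contDiff_infty_iff_deriv.1 hg).2.differentiable (by simp)
  have hs := hdψ.div (hasDerivAt_id ‖x‖) hr.ne'
  have hg2 : HasDerivAt (fun r : ℝ => deriv g (r ^ 2 / R ^ 2)) _ ‖x‖ :=
    HasDerivAt.comp (h₂ := deriv g) ‖x‖ (hdg (‖x‖ ^ 2 / R ^ 2)).hasDerivAt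
      ((hasDerivAt_pow 2 ‖x‖).div_const (R ^ 2))
  have hh : HasDerivAt (fun r : ℝ => (ψ r / r) ^ N * (2 / R ^ 2 * deriv g (r ^ 2 / R ^ 2))) _ ‖x‖ :=
    (hs.pow N).mul (hg2.const_mul (2 / R ^ 2))
  have hev (i : Fin (N + 1)) : (fun y => volumeDensity (modelMetric ψ) y *
      gradComponent (modelMetric ψ) (fun y => g (‖y‖ ^ 2 / R ^ 2)) i y) =ᶠ[𝓝 x]
      fun y => (ψ ‖y‖ / ‖y‖) ^ N * (2 / R ^ 2 * deriv g (‖y‖ ^ 2 / R ^ 2)) * y i := by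
    filter_upwards [isOpen_ne.mem_nhds hx] with y hy
    have hyp := hψ.pos _ (norm_pos_iff.2 hy)
    rw [volumeDensity_eq hy hyp, gradComponent_radial (hg.differentiable (by simp)) hy hyp.ne']
    ring
  -- The subtraction in `N - 1` is truncated; at `N = 0` the factor `N` kills both sides.
  have hpow : (N : ℝ) * (ψ ‖x‖ / ‖x‖) ^ (N - 1) = N * (ψ ‖x‖ / ‖x‖) ^ N * (‖x‖ / ψ ‖x‖) := by
    rcases N with _ | N
    · simp
    · rw [pow_succ, Nat.add_sub_cancel]
      field_simp
  simp only [laplaceBeltrami, (hev _).fderiv_eq, fderiv_radial_mul_coord hx hh]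
  rw [Finset.sum_add_distrib, ← Finset.mul_sum, ← EuclideanSpace.real_norm_sq_eq,
    volumeDensity_eq hx hp]
  simp only [Finset.sum_const, Finset.card_univ, Fintype.card_fin, nsmul_eq_mul, id, Pi.div_apply,
    Pi.pow_apply, hpow]
  push_cast
  field_simp
  ring

lemma laplaceBeltrami_eq_zero {m : Space n → Space n → Space n → ℝ} {f : Space n → ℝ} {c : ℝ}
    {x : Space n} (h : f =ᶠ[𝓝 x] fun _ => c) : laplaceBeltrami m f x = 0 := by
  have hev (i : Fin n) : (fun y => volumeDensity m y * gradComponent m f i y) =ᶠ[𝓝 x]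
      fun _ => 0 := by
    filter_upwards [h.eventuallyEq_nhds] with y hy
    simp [gradComponent, hy.fderiv_eq]
  simp [laplaceBeltrami, (hev _).fderiv_eq]

end Geometry

/-! ### The cutoff and its Laplacian -/

lemma contDiff_deriv_infty {f : ℝ → ℝ} (hf : ContDiff ℝ ∞ f) : ContDiff ℝ ∞ (deriv f) :=
  (contDiff_infty_iff_deriv.1 hf).2

lemma exists_bound_of_eq_zero_off_Icc {f : ℝ → ℝ} (hf : Continuous f) {a b : ℝ}
    (h : ∀ t ∉ Icc a b, f t = 0) : ∃ C, 0 ≤ C ∧ ∀ t, |f t| ≤ C := by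
  obtain ⟨C, hC⟩ := hf.bounded_above_of_compact_support (HasCompactSupport.intro isCompact_Icc h)
  exact ⟨C, (norm_nonneg _).trans (hC 0), hC⟩

/-- A high power `g = χ^(m+2)` of a standard cutoff works: two derivatives cost at most two factors
of `χ`, and `χ^m ≤ g^(1/q)` once `(m + 2)/q ≤ m`. -/
lemma exists_cutoff {q : ℝ} (hq : 1 < q) : ∃ (g : ℝ → ℝ) (C : ℝ), 0 ≤ C ∧ ContDiff ℝ ∞ g ∧
    (∀ t ≤ 1, g t = 1) ∧ (∀ t, 4 ≤ t → g t = 0) ∧ (∀ t, 0 ≤ g t) ∧ (∀ t, g t ≤ 1) ∧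
    (∀ t, deriv g t ≤ 0) ∧ (∀ t, |deriv g t| ≤ C * g t ^ (1 / q)) ∧
    (∀ t, |deriv (deriv g) t| ≤ C * g t ^ (1 / q)) := by
  set χ : ℝ → ℝ := fun t => Real.smoothTransition ((4 - t) / 3) with hχ
  have hχs : ContDiff ℝ ∞ χ :=
    Real.smoothTransition.contDiff.comp ((contDiff_const.sub contDiff_id).div_const 3)
  have hχ1 : ∀ t ≤ 1, χ t = 1 := fun t ht => Real.smoothTransition.one_of_one_le (by linarith)
  have hχ0 : ∀ t, 4 ≤ t → χ t = 0 := fun t ht => Real.smoothTransition.zero_of_nonpos (by linarith)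
  have hχn : ∀ t, 0 ≤ χ t := fun t => Real.smoothTransition.nonneg _
  have hχl : ∀ t, χ t ≤ 1 := fun t => Real.smoothTransition.le_one _
  have hχa : Antitone χ := fun a b hab => Real.smoothTransition.monotone (by linarith)
  have hd : Differentiable ℝ χ := hχs.differentiable (by simp)
  have hχs' := contDiff_deriv_infty hχs
  have hd' : Differentiable ℝ (deriv χ) := hχs'.differentiable (by simp)
  have hloc : ∀ t ∉ Icc (1 : ℝ) 4, ∃ c, χ =ᶠ[𝓝 t] fun _ => c := by
    intro t ht
    rcases lt_or_ge t 1 with h | h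
    · exact ⟨1, by filter_upwards [Iio_mem_nhds h] with s hs using hχ1 s hs.le⟩
    · have h4 : 4 < t := by by_contra! h4; exact ht ⟨h, h4⟩
      exact ⟨0, by filter_upwards [Ioi_mem_nhds h4] with s hs using hχ0 s hs.le⟩
  obtain ⟨C₁, hC₁, hb₁⟩ := exists_bound_of_eq_zero_off_Icc (f := deriv χ) hχs'.continuous
    (a := 1) (b := 4) (fun t ht => by obtain ⟨c, hc⟩ := hloc t ht; simp [hc.deriv_eq])
  obtain ⟨C₂, hC₂, hb₂⟩ := exists_bound_of_eq_zero_off_Icc (f := deriv (deriv χ))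
    (contDiff_deriv_infty hχs').continuous (a := 1) (b := 4)
    (fun t ht => by obtain ⟨c, hc⟩ := hloc t ht; simp [hc.deriv.deriv_eq])
  obtain ⟨m, hm⟩ := exists_nat_ge (2 / (1 - 1 / q))
  have hq1 : 0 < 1 - 1 / q := by rw [sub_pos, div_lt_one (by linarith)]; exact hq
  have hm' : ((m + 2 : ℕ) : ℝ) * (1 / q) ≤ m := by
    rw [div_le_iff₀ hq1] at hm
    have : 1 / q ≤ 1 := by linarith
    push_cast
    linarith
  have hpow : ∀ t, χ t ^ m ≤ (χ t ^ (m + 2)) ^ (1 / q) := by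
    intro t
    rw [← Real.rpow_natCast, ← Real.rpow_natCast, ← Real.rpow_mul (hχn t)]
    exact Real.rpow_le_rpow_of_exponent_ge' (hχn t) (hχl t) (by positivity) hm'
  have hpow' : ∀ t, χ t ^ (m + 1) ≤ (χ t ^ (m + 2)) ^ (1 / q) := fun t =>
    (pow_le_pow_of_le_one (hχn t) (hχl t) m.le_succ).trans (hpow t)
  have hg1 : deriv (fun t => χ t ^ (m + 2)) = fun t => (m + 2) * χ t ^ (m + 1) * deriv χ t := by
    ext t
    rw [((hd t).hasDerivAt.fun_pow (m + 2)).deriv]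
    simp
  have hg2 (t : ℝ) : deriv (deriv fun t => χ t ^ (m + 2)) t =
      (m + 2) * (m + 1) * deriv χ t ^ 2 * χ t ^ m +
        (m + 2) * deriv (deriv χ) t * χ t ^ (m + 1) := by
    rw [hg1, ((((hd t).hasDerivAt.fun_pow (m + 1)).const_mul (m + 2 : ℝ)).fun_mul
      (hd' t).hasDerivAt).deriv]
    simp
    ring
  refine ⟨fun t => χ t ^ (m + 2), (m + 2) * C₁ + ((m + 2) * (m + 1) * C₁ ^ 2 + (m + 2) * C₂),
    by positivity, hχs.pow _, fun t ht => by simp [hχ1 t ht], fun t ht => by simp [hχ0 t ht],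
    fun t => pow_nonneg (hχn t) _, fun t => pow_le_one₀ (hχn t) (hχl t), fun t => ?_, fun t => ?_,
    fun t => ?_⟩
  · rw [hg1]
    have := hχn t
    exact mul_nonpos_of_nonneg_of_nonpos (by positivity) hχa.deriv_nonpos
  · have h0 := hχn t
    have h1 : |deriv (fun t => χ t ^ (m + 2)) t| ≤ (m + 2) * C₁ * (χ t ^ (m + 2)) ^ (1 / q) := by
      rw [hg1, abs_mul, abs_of_nonneg (by positivity), mul_right_comm]
      have := hb₁ t
      have := hpow' t
      gcongr
    refine h1.trans ?_
    gcongr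
    exact le_add_of_nonneg_right (by positivity)
  · have h0 := hχn t
    have h1 : |deriv (deriv fun t => χ t ^ (m + 2)) t| ≤
        ((m + 2) * (m + 1) * C₁ ^ 2 + (m + 2) * C₂) * (χ t ^ (m + 2)) ^ (1 / q) := by
      rw [hg2, add_mul _ ((m + 2) * C₂)]
      refine (abs_add_le _ _).trans (add_le_add ?_ ?_)
      · rw [abs_mul, abs_mul, abs_of_nonneg (pow_nonneg h0 m), abs_pow,
          abs_of_nonneg (by positivity : (0 : ℝ) ≤ (m + 2) * (m + 1))]
        have := hb₁ t
        have := hpow t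
        gcongr
      · rw [abs_mul, abs_mul, abs_of_nonneg (pow_nonneg h0 (m + 1)),
          abs_of_nonneg (by positivity : (0 : ℝ) ≤ m + 2)]
        have := hb₂ t
        have := hpow' t
        gcongr
    have h2 : 0 ≤ (χ t ^ (m + 2)) ^ (1 / q) := by positivity
    exact h1.trans (mul_le_mul_of_nonneg_right (le_add_of_nonneg_left (by positivity)) h2)

/-- The closed annulus `R ≤ |x| ≤ 2R`. -/
def annulus (n : ℕ) (R : ℝ) : Set (Space n) := {x | R ≤ ‖x‖ ∧ ‖x‖ ≤ 2 * R}

lemma neg_laplaceBeltrami_cutoff_le {ψ : ℝ → ℝ} (hψ : IsModelFunction ψ) {K : ℝ} (hK : 0 < K)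
    (hψ_log : ∀ r : ℝ, 0 < r → deriv ψ r / ψ r ≤ K / r) {g : ℝ → ℝ} {C p : ℝ}
    (hg : ContDiff ℝ ∞ g) (hg1 : ∀ t ≤ 1, g t = 1) (hg4 : ∀ t, 4 ≤ t → g t = 0)
    (hg' : ∀ t, deriv g t ≤ 0) (hb₁ : ∀ t, |deriv g t| ≤ C * g t ^ p)
    (hb₂ : ∀ t, |deriv (deriv g) t| ≤ C * g t ^ p) {R : ℝ} (hR : 0 < R) {N : ℕ}
    (x : Space (N + 1)) :
    -laplaceBeltrami (modelMetric ψ) (fun y => g (‖y‖ ^ 2 / R ^ 2)) x ≤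
      (annulus (N + 1) R).indicator
        (fun x => 2 * (N * K + 9) * C / R ^ 2 * g (‖x‖ ^ 2 / R ^ 2) ^ p) x := by
  by_cases hx : x ∈ annulus (N + 1) R
  · rw [indicator_of_mem hx]
    have hr : 0 < ‖x‖ := hR.trans_le hx.1
    rw [laplaceBeltrami_radial hψ hg hR.ne' (norm_pos_iff.1 hr)]
    set t := ‖x‖ ^ 2 / R ^ 2 with ht
    have ht0 : 0 ≤ t := by positivity
    have ht4 : t ≤ 4 := by
      rw [ht, div_le_iff₀ (by positivity)]
      nlinarith [hx.2]
    have hlog : ‖x‖ * (deriv ψ ‖x‖ / ψ ‖x‖) ≤ K := by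
      have := mul_le_mul_of_nonneg_left (hψ_log _ hr) hr.le
      rwa [mul_div_cancel₀ _ hr.ne'] at this
    have h1 : -((N * (‖x‖ * (deriv ψ ‖x‖ / ψ ‖x‖)) + 1) * deriv g t) ≤
        (N * K + 1) * (C * g t ^ p) := by
      rw [← mul_neg]
      have h2 : -deriv g t ≤ C * g t ^ p := (neg_le_abs _).trans (hb₁ t)
      have h3 : 0 ≤ -deriv g t := neg_nonneg.2 (hg' t)
      calc _ ≤ (N * K + 1) * (-deriv g t) := by gcongr
        _ ≤ _ := by gcongr
    have h2 : -(2 * t * deriv (deriv g) t) ≤ 8 * (C * g t ^ p) := by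
      rw [← mul_neg]
      calc _ ≤ 2 * t * |deriv (deriv g) t| := by gcongr; exact neg_le_abs _
        _ ≤ 2 * 4 * (C * g t ^ p) := by gcongr; exact hb₂ t
        _ = _ := by ring
    calc _ = 2 / R ^ 2 * (-((N * (‖x‖ * (deriv ψ ‖x‖ / ψ ‖x‖)) + 1) * deriv g t) +
          -(2 * t * deriv (deriv g) t)) := by ring
      _ ≤ 2 / R ^ 2 * ((N * K + 1) * (C * g t ^ p) + 8 * (C * g t ^ p)) := by gcongr
      _ = _ := by ring
  -- Off the annulus, pole included, the cutoff is locally constant, so the form of the metric there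
  -- is irrelevant.
  · rw [indicator_of_notMem hx]
    have hloc : ∃ c, (fun y : Space (N + 1) => g (‖y‖ ^ 2 / R ^ 2)) =ᶠ[𝓝 x] fun _ => c := by
      rcases lt_or_ge ‖x‖ R with h | h
      · refine ⟨1, ?_⟩
        filter_upwards [continuous_norm.continuousAt.eventually_lt_const h] with y hy
        refine hg1 _ (div_le_one_of_le₀ ?_ (by positivity))
        gcongr
      · have h4 : 2 * R < ‖x‖ := by by_contra! h4; exact hx ⟨h, h4⟩
        refine ⟨0, ?_⟩
        filter_upwards [continuous_norm.continuousAt.eventually_const_lt h4] with y hy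
        refine hg4 _ ((le_div_iff₀ (by positivity)).2 ?_)
        nlinarith
    obtain ⟨c, hc⟩ := hloc
    rw [laplaceBeltrami_eq_zero hc, neg_zero]

/-! ### Volume growth, the critical exponent and the weighted integral estimate -/

lemma isClosed_annulus (n : ℕ) (R : ℝ) : IsClosed (annulus n R) :=
  (isClosed_le continuous_const continuous_norm).inter
    (isClosed_le continuous_norm continuous_const)

/-- The density `(ψ/r)^N` contributes the power `(α - 1)N` of `2R` and the Euclidean ball `N + 1`,
in total `αN + 1`. -/
lemma riemannianVolume_annulus_le {ψ : ℝ → ℝ} (hψ : IsModelFunction ψ) {α K r₀ : ℝ} (hα : 1 < α)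
    (hK : 0 < K) (hψ_growth : ∀ r : ℝ, r₀ ≤ r → ψ r ≤ K * r ^ α) {N : ℕ} {R : ℝ} (hR : 0 < R)
    (hR₀ : r₀ ≤ R) :
    riemannianVolume (modelMetric (n := N + 1) ψ) (annulus (N + 1) R) ≤
      ENNReal.ofReal (K ^ N * (2 * R) ^ (α * N + 1) *
        volume.real (Metric.ball (0 : Space (N + 1)) 1)) := by
  have hA := (isClosed_annulus (N + 1) R).measurableSet
  have hdens : ∀ x ∈ annulus (N + 1) R, ENNReal.ofReal (volumeDensity (modelMetric ψ) x) ≤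
      ENNReal.ofReal ((K * (2 * R) ^ (α - 1)) ^ N) := by
    intro x hx
    have hr : 0 < ‖x‖ := hR.trans_le hx.1
    have hp := hψ.pos _ hr
    rw [volumeDensity_eq (norm_pos_iff.1 hr) hp]
    have h1 : ψ ‖x‖ / ‖x‖ ≤ K * (2 * R) ^ (α - 1) := by
      rw [div_le_iff₀ hr]
      calc ψ ‖x‖ ≤ K * ‖x‖ ^ α := hψ_growth _ (hR₀.trans hx.1)
        _ = K * ‖x‖ ^ (α - 1) * ‖x‖ := by
          rw [mul_assoc, ← Real.rpow_add_one hr.ne', sub_add_cancel]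
        _ ≤ K * (2 * R) ^ (α - 1) * ‖x‖ := by
          have h2 := Real.rpow_le_rpow hr.le hx.2 (by linarith : 0 ≤ α - 1)
          gcongr
    gcongr
  have hvol : volume (annulus (N + 1) R) ≤
      ENNReal.ofReal ((2 * R) ^ (N + 1) * volume.real (Metric.ball (0 : Space (N + 1)) 1)) := by
    have hsub : annulus (N + 1) R ⊆ Metric.closedBall 0 (2 * R) := fun x hx => by
      simpa using hx.2
    refine (measure_mono hsub).trans_eq ?_
    rw [Measure.addHaar_closedBall _ _ (by positivity), ENNReal.ofReal_mul (by positivity),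
      finrank_euclideanSpace_fin, ofReal_measureReal]
  have hpow : ((2 * R) ^ (α - 1)) ^ N * (2 * R) ^ (N + 1) = (2 * R) ^ (α * N + 1) := by
    rw [← Real.rpow_natCast, ← Real.rpow_mul (by positivity), ← Real.rpow_natCast,
      ← Real.rpow_add (by positivity)]
    congr 1
    push_cast
    ring
  calc riemannianVolume (modelMetric ψ) (annulus (N + 1) R)
      = ∫⁻ x in annulus (N + 1) R, ENNReal.ofReal (volumeDensity (modelMetric ψ) x) :=
        withDensity_apply _ hA
    _ ≤ ∫⁻ _ in annulus (N + 1) R, ENNReal.ofReal ((K * (2 * R) ^ (α - 1)) ^ N) :=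
        setLIntegral_mono measurable_const hdens
    _ = ENNReal.ofReal ((K * (2 * R) ^ (α - 1)) ^ N) * volume (annulus (N + 1) R) := by
        rw [setLIntegral_const]
    _ ≤ ENNReal.ofReal ((K * (2 * R) ^ (α - 1)) ^ N) * ENNReal.ofReal
          ((2 * R) ^ (N + 1) * volume.real (Metric.ball (0 : Space (N + 1)) 1)) := by gcongr
    _ = _ := by
        rw [← ENNReal.ofReal_mul (by positivity), mul_pow, ← hpow]
        congr 1
        ring

lemma mul_add_one_le_of_le_lowerCriticalExponent {N : ℕ} (hN : 1 ≤ N) {α q : ℝ} (hα : 1 < α)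
    (hq : 1 < q) (h : q ≤ lowerCriticalExponent (N + 1) α) : α * N + 1 ≤ 2 * (q / (q - 1)) := by
  have hN' : (1 : ℝ) ≤ N := by exact_mod_cast hN
  have h0 : 0 < α * N - 1 := by nlinarith
  simp only [lowerCriticalExponent, Nat.cast_add, Nat.cast_one, add_sub_cancel_right] at h
  rw [le_div_iff₀ h0] at h
  rw [← mul_div_assoc, le_div_iff₀ (by linarith)]
  linarith

/-- A weighted form of Young's inequality. -/
lemma young_weighted {q a b c : ℝ} (hq : 1 < q) (ha : 0 ≤ a) (hb : 0 ≤ b) (hc : 0 < c) :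
    a * b ≤ c ^ q * a ^ q + (b / c) ^ (q / (q - 1)) := by
  have hpq : q.HolderConjugate (q / (q - 1)) := Real.HolderConjugate.conjExponent hq
  have h := Real.young_inequality_of_nonneg (mul_nonneg hc.le ha) (div_nonneg hb hc.le) hpq
  rw [Real.mul_rpow hc.le ha] at h
  calc a * b = c * a * (b / c) := by field_simp
    _ ≤ _ := h
    _ ≤ _ := add_le_add (div_le_self (by positivity) hq.le)
      (div_le_self (by positivity) hpq.symm.lt.le)

lemma integral_rpow_mul_cutoff_le {ψ : ℝ → ℝ} (hψ : IsModelFunction ψ) {α K r₀ : ℝ} (hα : 1 < α)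
    (hK : 0 < K) (hψ_log : ∀ r : ℝ, 0 < r → deriv ψ r / ψ r ≤ K / r)
    (hψ_growth : ∀ r : ℝ, r₀ ≤ r → ψ r ≤ K * r ^ α) {N : ℕ} {q : ℝ} (hq : 1 < q)
    (hQ : α * N + 1 ≤ 2 * (q / (q - 1))) {u : Space (N + 1) → ℝ}
    (hu_nonneg : ∀ᵐ x ∂(riemannianVolume (modelMetric (n := N + 1) ψ)), 0 ≤ u x)
    (hu : IsDistribSupersolution (modelMetric (n := N + 1) ψ) q u) {g : ℝ → ℝ} {C : ℝ}
    (hC : 0 ≤ C) (hg : ContDiff ℝ ∞ g) (hg1 : ∀ t ≤ 1, g t = 1) (hg4 : ∀ t, 4 ≤ t → g t = 0)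
    (hg0 : ∀ t, 0 ≤ g t) (hg' : ∀ t, deriv g t ≤ 0)
    (hb₁ : ∀ t, |deriv g t| ≤ C * g t ^ (1 / q))
    (hb₂ : ∀ t, |deriv (deriv g) t| ≤ C * g t ^ (1 / q)) :
    ∃ E : ℝ, ∀ R : ℝ, 1 ≤ R → r₀ ≤ R →
      Integrable (fun x => u x ^ q * g (‖x‖ ^ 2 / R ^ 2))
        (riemannianVolume (modelMetric (n := N + 1) ψ)) ∧
      ∀ c : ℝ, 0 < c → ∫ x, u x ^ q * g (‖x‖ ^ 2 / R ^ 2)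
          ∂(riemannianVolume (modelMetric (n := N + 1) ψ)) ≤
        c ^ q * ∫ x in annulus (N + 1) R, u x ^ q * g (‖x‖ ^ 2 / R ^ 2)
          ∂(riemannianVolume (modelMetric (n := N + 1) ψ)) + E * c ^ (-(q / (q - 1))) := by
  set ν := riemannianVolume (modelMetric (n := N + 1) ψ) with hν
  set q' := q / (q - 1) with hq'
  set D := 2 * (N * K + 9) * C with hD
  have hD0 : 0 ≤ D := by positivity
  have hq0 : 0 < q := by linarith
  set V := volume.real (Metric.ball (0 : Space (N + 1)) 1) with hV
  -- Young's remainder times the annulus volume, with the powers of `R` and `c` taken out.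
  refine ⟨D ^ q' * (K ^ N * 2 ^ (α * N + 1) * V), fun R hR1 hRr => ?_⟩
  have hR : 0 < R := by linarith
  set f : Space (N + 1) → ℝ := fun x => g (‖x‖ ^ 2 / R ^ 2) with hf
  have hfs : ContDiff ℝ ∞ f := hg.comp ((contDiff_norm_sq ℝ).div_const _)
  have hf0 : ∀ x ∉ Metric.closedBall (0 : Space (N + 1)) (2 * R), f x = 0 := fun x hx => by
    rw [Metric.mem_closedBall, dist_zero_right, not_le] at hx
    refine hg4 _ ((le_div_iff₀ (by positivity)).2 ?_)
    nlinarith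
  have hfc : HasCompactSupport f := HasCompactSupport.intro (isCompact_closedBall _ _) hf0
  have hfn : ∀ x, 0 ≤ f x := fun x => hg0 _
  have hI1 : Integrable (fun x => u x ^ q * f x) ν := by
    simpa [mul_comm] using hu.locallyIntegrable_rpow.integrable_smul_left_of_hasCompactSupport
      hfs.continuous hfc
  have hfp : Continuous fun x => f x ^ (1 / q) :=
    hfs.continuous.rpow_const fun x => Or.inr (by positivity)
  have hI2 : Integrable (fun x => u x * f x ^ (1 / q)) ν := by
    simpa [mul_comm] using hu.locallyIntegrable.integrable_smul_left_of_hasCompactSupport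
      hfp (HasCompactSupport.intro (isCompact_closedBall (0 : Space (N + 1)) (2 * R))
        fun x hx => by rw [hf0 x hx, Real.zero_rpow (by positivity)])
  have hA := (isClosed_annulus (N + 1) R).measurableSet
  have hvol := riemannianVolume_annulus_le hψ hα hK hψ_growth (N := N) hR hRr
  have hfin : ν (annulus (N + 1) R) ≠ ⊤ := (hvol.trans_lt ENNReal.ofReal_lt_top).ne
  refine ⟨hI1, fun c hc => ?_⟩
  have h1 : ∫ x, u x * (-laplaceBeltrami (modelMetric ψ) f x) ∂ν ≤
      ∫ x in annulus (N + 1) R, u x * f x ^ (1 / q) * (D / R ^ 2) ∂ν := by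
    rw [← integral_indicator hA]
    have hle : ∀ᵐ x ∂ν, u x * (-laplaceBeltrami (modelMetric ψ) f x) ≤
        (annulus (N + 1) R).indicator (fun x => u x * f x ^ (1 / q) * (D / R ^ 2)) x := by
      filter_upwards [hu_nonneg] with x hx
      refine (mul_le_mul_of_nonneg_left (neg_laplaceBeltrami_cutoff_le hψ hK hψ_log hg hg1 hg4 hg'
        hb₁ hb₂ hR x) hx).trans_eq ?_
      by_cases h : x ∈ annulus (N + 1) R
      · simp only [indicator_of_mem h, hf, hD]
        ring
      · simp [indicator_of_notMem h]
    -- Integrability need not be proved: otherwise the Bochner integral is `0` by convention, and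
    -- the right side is nonnegative.
    by_cases hint : Integrable (fun x => u x * (-laplaceBeltrami (modelMetric ψ) f x)) ν
    · exact integral_mono_ae hint ((hI2.mul_const _).indicator hA) hle
    · rw [integral_undef hint]
      refine integral_nonneg_of_ae ?_
      filter_upwards [hu_nonneg] with x hx
      refine indicator_apply_nonneg fun _ => ?_
      have := hfn x
      positivity
  have h2 : ∫ x in annulus (N + 1) R, u x * f x ^ (1 / q) * (D / R ^ 2) ∂ν ≤
      ∫ x in annulus (N + 1) R, (c ^ q * (u x ^ q * f x) + (D / R ^ 2 / c) ^ q') ∂ν := by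
    refine integral_mono_ae (hI2.mul_const _).integrableOn
      ((hI1.const_mul _).integrableOn.add (integrableOn_const hfin)) ?_
    filter_upwards [ae_restrict_of_ae hu_nonneg] with x hx
    have h3 := young_weighted (a := u x * f x ^ (1 / q)) (b := D / R ^ 2) hq
      (mul_nonneg hx (Real.rpow_nonneg (hfn x) _)) (by positivity) hc
    rwa [Real.mul_rpow hx (Real.rpow_nonneg (hfn x) _), ← Real.rpow_mul (hfn x),
      one_div_mul_cancel hq0.ne', Real.rpow_one] at h3
  have h3 : (D / R ^ 2 / c) ^ q' * ν.real (annulus (N + 1) R) ≤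
      D ^ q' * (K ^ N * 2 ^ (α * N + 1) * V) * c ^ (-q') := by
    have hv : ν.real (annulus (N + 1) R) ≤ K ^ N * (2 * R) ^ (α * N + 1) * V :=
      ENNReal.toReal_le_of_le_ofReal (by positivity) hvol
    -- Subcriticality and `R ≥ 1` let the decay `R^(-2q')` beat the volume growth.
    have hRpow : R ^ (α * N + 1) ≤ (R ^ 2) ^ q' := by
      rw [← Real.rpow_natCast, ← Real.rpow_mul hR.le]
      exact Real.rpow_le_rpow_of_exponent_le hR1 (by exact_mod_cast hQ)
    rw [Real.div_rpow (by positivity) hc.le, Real.div_rpow hD0 (by positivity), Real.rpow_neg hc.le]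
    calc D ^ q' / (R ^ 2) ^ q' / c ^ q' * ν.real (annulus (N + 1) R)
        ≤ D ^ q' / (R ^ 2) ^ q' / c ^ q' * (K ^ N * (2 ^ (α * N + 1) * (R ^ 2) ^ q') * V) := by
          rw [Real.mul_rpow zero_le_two hR.le] at hv
          have hv' : ν.real (annulus (N + 1) R) ≤
              K ^ N * (2 ^ (α * N + 1) * (R ^ 2) ^ q') * V := hv.trans (by gcongr)
          gcongr
      _ = _ := by
          have : (R ^ 2) ^ q' ≠ 0 := by positivity
          field_simp
  calc ∫ x, u x ^ q * f x ∂ν ≤ _ := hu.integral_le f hfs hfc hfn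
    _ ≤ _ := h1
    _ ≤ _ := h2
    _ = c ^ q * ∫ x in annulus (N + 1) R, u x ^ q * f x ∂ν +
        (D / R ^ 2 / c) ^ q' * ν.real (annulus (N + 1) R) := by
      rw [integral_add (hI1.const_mul _).integrableOn (integrableOn_const hfin),
        integral_const_mul, setIntegral_const, smul_eq_mul, mul_comm (ν.real _)]
    _ ≤ _ := by gcongr

end LaneEmden

/-! ### Integrability of `u^q` and the two limits -/

theorem mainTheorem1 (n : ℕ) (hn : 2 ≤ n) (α : ℝ) (hα : 1 < α)
    (ψ : ℝ → ℝ) (hψ : LaneEmden.IsModelFunction ψ)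
    (K r₀ : ℝ) (hK : 0 < K) (hr₀ : 0 < r₀)
    (hψ_log : ∀ r : ℝ, 0 < r → deriv ψ r / ψ r ≤ K / r)
    (hψ_growth : ∀ r : ℝ, r₀ ≤ r → ψ r ≤ K * r ^ α)
    (q : ℝ) (hq : 1 < q) (hq_le : q ≤ LaneEmden.lowerCriticalExponent n α)
    (u : LaneEmden.Space n → ℝ)
    (hu_nonneg : ∀ᵐ x ∂(LaneEmden.riemannianVolume (LaneEmden.modelMetric (n := n) ψ)), 0 ≤ u x)
    (hu : LaneEmden.IsDistribSupersolution (LaneEmden.modelMetric (n := n) ψ) q u) :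
    ∀ᵐ x ∂(LaneEmden.riemannianVolume (LaneEmden.modelMetric (n := n) ψ)), u x = 0 := by
  obtain ⟨N, rfl⟩ : ∃ N, n = N + 1 := ⟨n - 1, by omega⟩
  obtain ⟨g, C, hC, hg, hg1, hg4, hg0, hgle, hg', hb₁, hb₂⟩ := LaneEmden.exists_cutoff hq
  have hQ := LaneEmden.mul_add_one_le_of_le_lowerCriticalExponent (by omega) hα hq hq_le
  obtain ⟨E, hE⟩ := LaneEmden.integral_rpow_mul_cutoff_le hψ hα hK hψ_log hψ_growth hq hQ
    hu_nonneg hu hC hg hg1 hg4 hg0 hg' hb₁ hb₂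
  set ν := LaneEmden.riemannianVolume (LaneEmden.modelMetric (n := N + 1) ψ) with hν
  have hq0 : 0 < q := by linarith
  have hF : ∀ᵐ x ∂ν, 0 ≤ u x ^ q := by
    filter_upwards [hu_nonneg] with x hx using Real.rpow_nonneg hx q
  have hFg (R : ℝ) : ∀ᵐ x ∂ν, 0 ≤ u x ^ q * g (‖x‖ ^ 2 / R ^ 2) := by
    filter_upwards [hF] with x hx using mul_nonneg hx (hg0 _)
  have hball (R : ℝ) : IntegrableOn (fun x => u x ^ q) (Metric.ball 0 R) ν :=
    (hu.locallyIntegrable_rpow.integrableOn_isCompact (isCompact_closedBall 0 R)).mono_set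
      Metric.ball_subset_closedBall
  have hball_le (R : ℝ) (hR : 1 ≤ R) (hRr : r₀ ≤ R) : ∫ x in Metric.ball 0 R, u x ^ q ∂ν ≤
      ∫ x, u x ^ q * g (‖x‖ ^ 2 / R ^ 2) ∂ν := by
    refine le_trans (le_of_eq ?_) (setIntegral_le_integral (s := Metric.ball 0 R)
      (hE R hR hRr).1 (hFg R))
    refine setIntegral_congr_fun Metric.isOpen_ball.measurableSet fun x hx => ?_
    have h1 : ‖x‖ ^ 2 / R ^ 2 ≤ 1 := by
      have := (mem_ball_zero_iff.1 hx).le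
      refine div_le_one_of_le₀ ?_ (by positivity)
      gcongr
    simp [hg1 _ h1]
  have hcov : AECover ν Filter.atTop fun R : ℝ => Metric.ball (0 : LaneEmden.Space (N + 1)) R :=
    aecover_ball Filter.tendsto_id
  have hint : Integrable (fun x => u x ^ q) ν := by
    -- Chosen so that `c^q = 1/2`: half of the left side absorbs the annulus term.
    set c : ℝ := (1 / 2) ^ (1 / q) with hc
    have hc0 : 0 < c := by positivity
    have hcq : c ^ q = 1 / 2 := by
      rw [hc, ← Real.rpow_mul (by norm_num), one_div_mul_cancel hq0.ne', Real.rpow_one]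
    refine hcov.integrable_of_integral_bounded_of_nonneg_ae (2 * (E * c ^ (-(q / (q - 1))))) hball
      hF ?_
    filter_upwards [Filter.eventually_ge_atTop 1, Filter.eventually_ge_atTop r₀]
      with R hR hRr
    have h1 := (hE R hR hRr).2 c hc0
    have h2 := setIntegral_le_integral (s := LaneEmden.annulus (N + 1) R) (hE R hR hRr).1 (hFg R)
    rw [hcq] at h1
    linarith [hball_le R hR hRr]
  set J := ∫ x, u x ^ q ∂ν with hJ
  have hlim : Filter.Tendsto (fun R : ℝ => ∫ x in Metric.ball 0 R, u x ^ q ∂ν) Filter.atTop (nhds J) :=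
    hcov.integral_tendsto_of_countably_generated hint
  have hJc : ∀ c : ℝ, 0 < c → J ≤ E * c ^ (-(q / (q - 1))) := by
    intro c hc
    -- The annulus lies outside the ball of radius `R`, so its integral is at most this tail, which
    -- tends to `0` for fixed `c`.
    have hlim' : Filter.Tendsto (fun R : ℝ => c ^ q * (J - ∫ x in Metric.ball 0 R, u x ^ q ∂ν) +
        E * c ^ (-(q / (q - 1)))) Filter.atTop (nhds (c ^ q * (J - J) + E * c ^ (-(q / (q - 1))))) :=
      ((hlim.const_sub J).const_mul _).add_const _
    rw [sub_self, mul_zero, zero_add] at hlim'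
    refine le_of_tendsto_of_tendsto hlim hlim' ?_
    filter_upwards [Filter.eventually_ge_atTop 1, Filter.eventually_ge_atTop r₀]
      with R hR hRr
    refine ((hball_le R hR hRr).trans ((hE R hR hRr).2 c hc)).trans ?_
    have h1 : ∫ x in LaneEmden.annulus (N + 1) R, u x ^ q * g (‖x‖ ^ 2 / R ^ 2) ∂ν ≤
        ∫ x in LaneEmden.annulus (N + 1) R, u x ^ q ∂ν := by
      refine integral_mono_ae (hE R hR hRr).1.integrableOn hint.integrableOn ?_
      filter_upwards [ae_restrict_of_ae hF] with x hx using mul_le_of_le_one_right hx (hgle _)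
    have h2 : ∫ x in LaneEmden.annulus (N + 1) R, u x ^ q ∂ν ≤
        ∫ x in (Metric.ball 0 R)ᶜ, u x ^ q ∂ν := by
      refine setIntegral_mono_set hint.integrableOn (ae_restrict_of_ae hF)
        (LE.le.eventuallyLE fun x hx => ?_)
      simpa using hx.1
    have h3 := integral_add_compl (Metric.isOpen_ball (x := (0 : LaneEmden.Space (N + 1)))
      (ε := R)).measurableSet hint
    gcongr
    linarith
  -- Now `c → ∞`, possible because no term `c^q` survives.
  have hJ0 : J ≤ 0 := by
    have hp : 0 < q / (q - 1) := div_pos hq0 (by linarith)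
    have h := (tendsto_rpow_neg_atTop hp).const_mul E
    rw [mul_zero] at h
    exact ge_of_tendsto h ((Filter.eventually_gt_atTop 0).mono hJc)
  have hzero := (integral_eq_zero_iff_of_nonneg_ae hF hint).1
    (le_antisymm hJ0 (integral_nonneg_of_ae hF))
  filter_upwards [hzero, hu_nonneg] with x hx hx0
  exact (Real.rpow_eq_zero hx0 hq0.ne').1 hx
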